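/- Let $K$ be a field and let $E=(E^0,E^1,r,s)$ be an arbitrary directed graph. Write $v\ge w$ if there is a path (possibly of length $0$) from $v$ to $w$. A set $H\subseteq E^0$ is hereditary if $v\in H$ and $v\ge w$ imply $w\in H$. A vertex $v$ is regular if $s^{-1}(v)$ is finite and nonempty. The saturated closure of $X\subseteq E^0$ is $\overline X=\bigcup_{n\ge 0}\Lambda_n(X)$, where $\Lambda_0(X)=X$ and $\Lambda_{n+1}(X)=\Lambda_n(X)\cup\{v \text{ regular} : r(s^{-1}(v))\subseteq \Lambda_n(X)\}$. The Leavitt path algebra $L_K(E)$ is the (not necessarily unital) associative $K$-algebra generated by the vertices $v\in E^0$, the edges $e\in E^1$ and the ghost edges $e^*$ ($e\in E^1$) subject to the relations $vw=\delta_{v,w}v$; $s(e)e=e=e\,r(e)$; $r(e)e^*=e^*=e^*s(e)$; $e^*f=\delta_{e,f}r(e)$; and $v=\sum_{s(e)=v}ee^*$ for every regular vertex $v$. For $X\subseteq E^0$ let $I(X)$ be the two-sided ideal of $L_K(E)$ generated by $X$. (1) Let $\{H_i\}_{i\in\Lambda}$ be a family of hereditary subsets of $E^0$ such that $H_i\cap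 H_j=\emptyset$ for all $i\ne j$. Then $$I\Big(\overline{\bigcup_{i\in\Lambda} H_i}\Big)=I\Big(\bigcup_{i\in\Lambda} H_i\Big)=\bigoplus_{i\in\Lambda} I(H_i)=\bigoplus_{i\in\Lambda} I(\overline{H_i}),$$ where the direct sums are internal direct sums of ideals of $L_K(E)$; moreover $I(H_i)=I(\overline{H_i})$ for every $i\in\Lambda$. (2) Call a graph connected if any two of its vertices are joined by a path (possibly of length $0$) consisting of edges and reversed edges. If $E=\bigsqcup_{i\in\Lambda}E_i$ is the disjoint union of subgraphs $E_i$ each of which is connected (the connected components of $E$), then $L_K(E)\cong\bigoplus_{i\in\Lambda}L_K(E_i)$ as $K$-algebras. -/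

import Mathlib

open scoped DirectSum

noncomputable section

universe u v

/-- A directed graph `(E⁰, E¹, r, s)`: a type of vertices, a type of edges, and the source and
range maps. No finiteness or countability is assumed. -/
structure DirectedGraph : Type (max (u + 1) (v + 1)) where
  /-- The vertices `E⁰`. -/
  Vertex : Type u
  /-- The edges `E¹`. -/
  Edge : Type v
  /-- The source map `s`. -/
  source : Edge → Vertex
  /-- The range map `r`. -/
  range : Edge → Vertex

namespace DirectedGraph

/-- `v ≥ w`: there is a path (possibly of length zero) from `v` to `w`, i.e. a finite chain
`v = v₀, v₁, …, vₙ = w` in which consecutive vertices are the source and the range of an edge. -/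
def Reaches (E : DirectedGraph.{u, v}) : E.Vertex → E.Vertex → Prop :=
  Relation.ReflTransGen fun a b => ∃ e : E.Edge, E.source e = a ∧ E.range e = b

/-- A set of vertices is hereditary if `v ≥ w` and `v ∈ H` imply `w ∈ H`. -/
def IsHereditary (E : DirectedGraph.{u, v}) (H : Set E.Vertex) : Prop :=
  ∀ v w : E.Vertex, E.Reaches v w → v ∈ H → w ∈ H

/-- The set `s⁻¹(v)` of the edges emitted by `v`. -/
def emitted (E : DirectedGraph.{u, v}) (v : E.Vertex) : Set E.Edge :=
  {e | E.source e = v}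

/-- A vertex is regular if it emits a finite, nonzero number of edges: it is neither an infinite
emitter nor a sink. -/
def IsRegular (E : DirectedGraph.{u, v}) (v : E.Vertex) : Prop :=
  (E.emitted v).Finite ∧ (E.emitted v).Nonempty

/-- The sets `Λₙ(X)`: `Λ₀(X) = X`, and `Λₙ₊₁(X)` is `Λₙ(X)` together with the regular vertices `v`
such that `r(s⁻¹(v)) ⊆ Λₙ(X)`. -/
def satStep (E : DirectedGraph.{u, v}) (X : Set E.Vertex) : ℕ → Set E.Vertex
  | 0 => X
  | n + 1 => satStep E X n ∪ {v | E.IsRegular v ∧ E.range '' E.emitted v ⊆ satStep E X n}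

/-- The saturated closure `⋃ₙ Λₙ(X)` of a set of vertices. -/
def satClosure (E : DirectedGraph.{u, v}) (X : Set E.Vertex) : Set E.Vertex :=
  ⋃ n : ℕ, E.satStep X n

/-- The extended graph: the vertices of `E`, the real edges `Sum.inl e`, and for every edge `e` a
ghost edge `Sum.inr e` in the opposite direction. -/
def extended (E : DirectedGraph.{u, v}) : DirectedGraph.{u, v} where
  Vertex := E.Vertex
  Edge := E.Edge ⊕ E.Edge
  source := Sum.elim E.source E.range
  range := Sum.elim E.range E.source

/-- A graph is connected if any two vertices are joined by a path in the extended graph. -/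
def IsConnected (E : DirectedGraph.{u, v}) : Prop :=
  ∀ a b : E.Vertex, E.extended.Reaches a b

/-- A subgraph of `E`: a set of vertices and a set of edges whose ends are among these vertices. -/
structure Subgraph (E : DirectedGraph.{u, v}) where
  /-- The vertices of the subgraph. -/
  verts : Set E.Vertex
  /-- The edges of the subgraph. -/
  edges : Set E.Edge
  source_mem : ∀ e ∈ edges, E.source e ∈ verts
  range_mem : ∀ e ∈ edges, E.range e ∈ verts

/-- A subgraph, as a graph in its own right. -/
def Subgraph.toGraph {E : DirectedGraph.{u, v}} (G : E.Subgraph) : DirectedGraph.{u, v} where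
  Vertex := G.verts
  Edge := G.edges
  source := fun e => ⟨E.source e.1, G.source_mem e.1 e.2⟩
  range := fun e => ⟨E.range e.1, G.range_mem e.1 e.2⟩

/-- `E` is the disjoint union of the subgraphs `G i`: every vertex and every edge of `E` belongs to
exactly one of them. -/
def IsDisjointUnion (E : DirectedGraph.{u, v}) {Λ : Type*} (G : Λ → E.Subgraph) : Prop :=
  (∀ a : E.Vertex, ∃! i, a ∈ (G i).verts) ∧ (∀ e : E.Edge, ∃! i, e ∈ (G i).edges)

end DirectedGraph

namespace Leavitt

/-- The generators of the Leavitt path algebra: the vertices, the (real) edges `e` and the ghost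
edges `e*`. -/
inductive Gen (E : DirectedGraph.{u, v}) : Type (max u v)
  | vertex (a : E.Vertex) : Gen E
  | edge (e : E.Edge) : Gen E
  | ghost (e : E.Edge) : Gen E

/-- The free associative, non-unital `K`-algebra on the generators: the semigroup algebra over `K`
of the free semigroup of nonempty words. -/
abbrev Free (K : Type*) [Field K] (E : DirectedGraph.{u, v}) :=
  MonoidAlgebra K (FreeSemigroup (Gen E))

/-- A generator, as an element of the free algebra. -/
def gen (K : Type*) [Field K] {E : DirectedGraph.{u, v}} (x : Gen E) : Free K E :=
  MonoidAlgebra.single (FreeSemigroup.of x) 1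

/-- The defining relations of the Leavitt path algebra: (V) `v w = δ_{v,w} v`; (E1)
`s(e) e = e = e r(e)`; (E2) `r(e) e* = e* = e* s(e)`; (CK1) `e* f = δ_{e,f} r(e)`; (CK2)
`v = ∑_{s(e) = v} e e*` for every regular vertex `v`. -/
inductive Rel (K : Type*) [Field K] (E : DirectedGraph.{u, v}) : Free K E → Free K E → Prop
  | vertex_self (a : E.Vertex) : Rel K E (gen K (.vertex a) * gen K (.vertex a)) (gen K (.vertex a))
  | vertex_ne (a b : E.Vertex) (h : a ≠ b) : Rel K E (gen K (.vertex a) * gen K (.vertex b)) 0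
  | source_edge (e : E.Edge) :
      Rel K E (gen K (.vertex (E.source e)) * gen K (.edge e)) (gen K (.edge e))
  | edge_range (e : E.Edge) :
      Rel K E (gen K (.edge e) * gen K (.vertex (E.range e))) (gen K (.edge e))
  | range_ghost (e : E.Edge) :
      Rel K E (gen K (.vertex (E.range e)) * gen K (.ghost e)) (gen K (.ghost e))
  | ghost_source (e : E.Edge) :
      Rel K E (gen K (.ghost e) * gen K (.vertex (E.source e))) (gen K (.ghost e))
  | ck1_self (e : E.Edge) :
      Rel K E (gen K (.ghost e) * gen K (.edge e)) (gen K (.vertex (E.range e)))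
  | ck1_ne (e f : E.Edge) (h : e ≠ f) : Rel K E (gen K (.ghost e) * gen K (.edge f)) 0
  | ck2 (a : E.Vertex) (h : E.IsRegular a) :
      Rel K E (gen K (.vertex a)) (∑ e ∈ h.1.toFinset, gen K (.edge e) * gen K (.ghost e))

/-- The scalar multiples of the defining relations. -/
def ScalarRel (K : Type*) [Field K] (E : DirectedGraph.{u, v}) (x y : Free K E) : Prop :=
  ∃ (k : K) (x' y' : Free K E), Rel K E x' y' ∧ x = k • x' ∧ y = k • y'

/-- The congruence modulo the algebra ideal generated by the defining relations. (The free algebra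
has no unit, so the ideal of the `K`-algebra generated by the relations is the ring ideal generated
by their scalar multiples.) -/
def con (K : Type*) [Field K] (E : DirectedGraph.{u, v}) : RingCon (Free K E) :=
  ringConGen (ScalarRel K E)

theorem con_smul {K : Type*} [Field K] {E : DirectedGraph.{u, v}} (k : K) {x y : Free K E}
    (hxy : con K E x y) : con K E (k • x) (k • y) := by
  change RingConGen.Rel (ScalarRel K E) x y at hxy
  induction hxy with
  | of x y hr =>
    obtain ⟨l, x', y', h0, h1, h2⟩ := hr
    exact RingConGen.Rel.of _ _ ⟨k * l, x', y', h0, by rw [h1, mul_smul], by rw [h2, mul_smul]⟩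
  | refl x => exact (con K E).refl _
  | symm _ ih => exact (con K E).symm ih
  | trans _ _ ih₁ ih₂ => exact (con K E).trans ih₁ ih₂
  | add _ _ ih₁ ih₂ =>
    rw [smul_add, smul_add]
    exact (con K E).add ih₁ ih₂
  | mul _ h₂ ih₁ _ =>
    rw [← smul_mul_assoc, ← smul_mul_assoc]
    exact (con K E).mul ih₁ h₂

end Leavitt

/-- The Leavitt path algebra `L_K(E)`: the (in general non-unital) `K`-algebra generated by the
vertices, edges and ghost edges of `E`, subject to (V), (E1), (E2), (CK1) and (CK2). -/
def LeavittPathAlgebra (K : Type*) [Field K] (E : DirectedGraph.{u, v}) :=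
  (Leavitt.con K E).Quotient

namespace LeavittPathAlgebra

instance instNonUnitalRing (K : Type*) [Field K] (E : DirectedGraph.{u, v}) :
    NonUnitalRing (LeavittPathAlgebra K E) :=
  inferInstanceAs (NonUnitalRing (Leavitt.con K E).Quotient)

/-- The quotient map from the free algebra to the Leavitt path algebra. -/
def mk (K : Type*) [Field K] (E : DirectedGraph.{u, v}) (x : Leavitt.Free K E) :
    LeavittPathAlgebra K E :=
  (x : (Leavitt.con K E).Quotient)

instance instSMul (K : Type*) [Field K] (E : DirectedGraph.{u, v}) :
    SMul K (LeavittPathAlgebra K E) where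
  smul k := Quotient.map' (k • ·) fun _ _ h => Leavitt.con_smul k h

instance instModule (K : Type*) [Field K] (E : DirectedGraph.{u, v}) :
    Module K (LeavittPathAlgebra K E) where
  one_smul := by
    rintro ⟨x⟩
    exact congrArg (mk K E) (one_smul K x)
  mul_smul k l := by
    rintro ⟨x⟩
    exact congrArg (mk K E) (mul_smul k l x)
  smul_zero k := congrArg (mk K E) (smul_zero k)
  smul_add k := by
    rintro ⟨x⟩ ⟨y⟩
    exact congrArg (mk K E) (smul_add k x y)
  add_smul k l := by
    rintro ⟨x⟩
    exact congrArg (mk K E) (add_smul k l x)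
  zero_smul := by
    rintro ⟨x⟩
    exact congrArg (mk K E) (zero_smul K x)

instance instIsScalarTower (K : Type*) [Field K] (E : DirectedGraph.{u, v}) :
    IsScalarTower K (LeavittPathAlgebra K E) (LeavittPathAlgebra K E) where
  smul_assoc k := by
    rintro ⟨x⟩ ⟨y⟩
    exact congrArg (mk K E) (smul_mul_assoc k x y)

instance instSMulCommClass (K : Type*) [Field K] (E : DirectedGraph.{u, v}) :
    SMulCommClass K (LeavittPathAlgebra K E) (LeavittPathAlgebra K E) where
  smul_comm k := by
    rintro ⟨x⟩ ⟨y⟩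
    exact congrArg (mk K E) (mul_smul_comm k x y).symm

/-- The element of `L_K(E)` given by a vertex. -/
def vertex (K : Type*) [Field K] {E : DirectedGraph.{u, v}} (a : E.Vertex) :
    LeavittPathAlgebra K E :=
  mk K E (Leavitt.gen K (.vertex a))

/-- The two-sided ideal `I(X)` of `L_K(E)` generated by a set `X` of vertices. -/
def ideal (K : Type*) [Field K] {E : DirectedGraph.{u, v}} (X : Set E.Vertex) :
    TwoSidedIdeal (LeavittPathAlgebra K E) :=
  TwoSidedIdeal.span (vertex K '' X)

end LeavittPathAlgebra

open Classical in
/-- The ideal `J` is the (internal) direct sum of the ideals `I i`: the addition map from the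
external direct sum `⨁ i, I i` to `R` is injective and its range is `J`. -/
def IsIdealDirectSum {R : Type*} [NonUnitalRing R] {Λ : Type*} (J : TwoSidedIdeal R)
    (I : Λ → TwoSidedIdeal R) : Prop :=
  Function.Injective (DirectSum.coeAddMonoidHom I) ∧
    Set.range (DirectSum.coeAddMonoidHom I) = (J : Set R)

/-- The (external) direct sum of a family of non-unital `K`-algebras: the families with finite
support, with the componentwise operations. -/
def algebraDirectSum (K : Type*) [Field K] {Λ : Type*} (A : Λ → Type*)
    [∀ i, NonUnitalRing (A i)] [∀ i, Module K (A i)] : NonUnitalSubalgebra K (∀ i, A i) where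
  carrier := {f | {i | f i ≠ 0}.Finite}
  zero_mem' := by simp
  add_mem' {f g} hf hg := (Set.Finite.union hf hg).subset fun i hi => by
    by_contra h
    simp only [Set.mem_union, Set.mem_ofPred_eq, not_or, not_not] at h
    exact hi (by simp [h.1, h.2])
  mul_mem' {f g} hf _ := Set.Finite.subset hf fun i hi h => hi (by simp [h])
  smul_mem' k f hf := Set.Finite.subset hf fun i hi h => hi (by simp [h])

end

/-!
The ideal `I(H)` of a hereditary set `H` consists of the linear combinations of elements `a β*`,
where `β` is a path ending in `H`: these combinations form a left ideal, and they are stable under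
right multiplication by the generators because an edge starting in `H` ends in `H`
(`mem_ghostSpan_of_mem_ideal`). Two facts follow.

* If `H` and `H'` are disjoint and hereditary, then `I(H) I(H') = 0`. Indeed `a β* v = 0` for
  `v ∈ H'`, since otherwise `v` would reach the end of `β`, which lies in `H`
  (`mul_eq_zero_of_mem_ideal`).
* Every `x ∈ I(H)` satisfies `x u = x` for some `u ∈ I(H)` (`exists_mul_eq_self`). A single `a β*`
  is fixed by right multiplication by `β β*`; these elements commute with each other
  (`commute_rangeProj`), so joins `u + p - u p` of finitely many of them fix sums.

In a sum of elements of the ideals `I(H i)`, a unit for one summand annihilates the others, so the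
sum is direct (`isIdealDirectSum_of_orthogonal`). Passing to saturated closures does not change the
ideals, because the last defining relation writes a regular vertex as `∑ e r(e) e*`
(`ideal_satClosure`).

For a disjoint union of subgraphs, the universal property gives, for each component, a homomorphism
`ι i` from its Leavitt path algebra and a homomorphism `π i` onto it which kills the generators of
the other components. Both respect the last defining relation because a component contains all
edges adjacent to its vertices. Generators of different components multiply to zero, hence
`x = ∑ ι i (π i x)` with finitely many nonzero terms, and the `π i` together form the isomorphism
(`exists_bijective_of_isDisjointUnion`).
-/

universe u v

namespace LeavittPathAlgebra

/-! ### Generators, relations and induction -/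

section Generators

variable {K : Type*} [Field K] {E : DirectedGraph.{u, v}}

/-- The element of `L_K(E)` given by a generator. -/
noncomputable def ofGen (K : Type*) [Field K] {E : DirectedGraph.{u, v}} (x : Leavitt.Gen E) :
    LeavittPathAlgebra K E :=
  mk K E (Leavitt.gen K x)

/-- The element `e` of `L_K(E)` given by a real edge. -/
noncomputable def edge (K : Type*) [Field K] {E : DirectedGraph.{u, v}} (e : E.Edge) : LeavittPathAlgebra K E :=
  ofGen K (.edge e)

/-- The element `e*` of `L_K(E)` given by a ghost edge. -/
noncomputable def ghost (K : Type*) [Field K] {E : DirectedGraph.{u, v}} (e : E.Edge) : LeavittPathAlgebra K E :=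
  ofGen K (.ghost e)

/-- The quotient map from the free algebra, as a homomorphism of non-unital algebras. -/
noncomputable def mkHom (K : Type*) [Field K] (E : DirectedGraph.{u, v}) :
    Leavitt.Free K E →ₙₐ[K] LeavittPathAlgebra K E where
  toFun := mk K E
  map_smul' _ _ := rfl
  map_zero' := rfl
  map_add' _ _ := rfl
  map_mul' _ _ := rfl

theorem mkHom_surjective : Function.Surjective (mkHom K E) := by
  rintro ⟨x⟩
  exact ⟨x, rfl⟩

theorem mkHom_eq_of_rel {x y : Leavitt.Free K E} (h : Leavitt.Rel K E x y) :
    mkHom K E x = mkHom K E y :=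
  ((Leavitt.con K E).eq).2
    (RingConGen.Rel.of _ _ ⟨1, x, y, h, (one_smul K x).symm, (one_smul K y).symm⟩)

theorem vertex_mul_self (a : E.Vertex) : vertex K a * vertex K a = vertex K a := by
  simpa using! mkHom_eq_of_rel (.vertex_self (K := K) a)

theorem vertex_mul_of_ne {a b : E.Vertex} (h : a ≠ b) : vertex K a * vertex K b = 0 := by
  simpa using! mkHom_eq_of_rel (.vertex_ne (K := K) a b h)

theorem source_mul_edge (e : E.Edge) : vertex K (E.source e) * edge K e = edge K e := by
  simpa using! mkHom_eq_of_rel (.source_edge (K := K) e)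

theorem edge_mul_range (e : E.Edge) : edge K e * vertex K (E.range e) = edge K e := by
  simpa using! mkHom_eq_of_rel (.edge_range (K := K) e)

theorem range_mul_ghost (e : E.Edge) : vertex K (E.range e) * ghost K e = ghost K e := by
  simpa using! mkHom_eq_of_rel (.range_ghost (K := K) e)

theorem ghost_mul_source (e : E.Edge) : ghost K e * vertex K (E.source e) = ghost K e := by
  simpa using! mkHom_eq_of_rel (.ghost_source (K := K) e)

theorem ghost_mul_edge_self (e : E.Edge) : ghost K e * edge K e = vertex K (E.range e) := by
  simpa using! mkHom_eq_of_rel (.ck1_self (K := K) e)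

theorem ghost_mul_edge_of_ne {e f : E.Edge} (h : e ≠ f) : ghost K e * edge K f = 0 := by
  simpa using! mkHom_eq_of_rel (.ck1_ne (K := K) e f h)

theorem vertex_eq_sum {a : E.Vertex} (h : E.IsRegular a) :
    vertex K a = ∑ e ∈ h.1.toFinset, edge K e * ghost K e := by
  have := mkHom_eq_of_rel (.ck2 (K := K) a h)
  rw [map_sum] at this
  exact this

theorem vertex_mul_edge_of_ne {a : E.Vertex} {e : E.Edge} (h : a ≠ E.source e) :
    vertex K a * edge K e = 0 := by
  rw [← source_mul_edge, ← mul_assoc, vertex_mul_of_ne h, zero_mul]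

theorem ghost_mul_vertex_of_ne {a : E.Vertex} {e : E.Edge} (h : E.source e ≠ a) :
    ghost K e * vertex K a = 0 := by
  rw [← ghost_mul_source, mul_assoc, vertex_mul_of_ne h, mul_zero]

/-- To prove a property of all elements of `L_K(E)` it suffices to treat generators, sums, scalar
multiples and products with a generator on the left. -/
@[elab_as_elim]
theorem induction_gen_mul {P : LeavittPathAlgebra K E → Prop} (x : LeavittPathAlgebra K E)
    (gen : ∀ g, P (ofGen K g)) (zero : P 0) (add : ∀ x y, P x → P y → P (x + y))
    (smul : ∀ (k : K) x, P x → P (k • x)) (gen_mul : ∀ g x, P x → P (ofGen K g * x)) : P x := by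
  obtain ⟨x, rfl⟩ := mkHom_surjective x
  have word (w : FreeSemigroup (Leavitt.Gen E)) : P (mkHom K E (MonoidAlgebra.single w 1)) := by
    induction w with
    | ih1 g => exact gen g
    | ih2 g w _ ih =>
      have : (MonoidAlgebra.single (FreeSemigroup.of g * w) 1 : Leavitt.Free K E) =
          Leavitt.gen K g * MonoidAlgebra.single w 1 := by
        simp [Leavitt.gen, MonoidAlgebra.single_mul_single]
      rw [this, map_mul]
      exact gen_mul g _ ih
  induction x using MonoidAlgebra.induction_linear with
  | zero => simpa using zero
  | add x y hx hy => simpa using add _ _ hx hy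
  | single w k =>
    have : (MonoidAlgebra.single w k : Leavitt.Free K E) = k • MonoidAlgebra.single w 1 := by simp
    rw [this, map_smul]
    exact smul k _ (word w)

/-- The homomorphism from the free algebra to `A` given by the images of the generators. -/
noncomputable def freeLift {A : Type*} [NonUnitalRing A] [Module K A] [IsScalarTower K A A]
    [SMulCommClass K A A] (f : Leavitt.Gen E → A) : Leavitt.Free K E →ₙₐ[K] A :=
  MonoidAlgebra.liftMagma K (FreeSemigroup.lift f)

@[simp]
theorem freeLift_gen {A : Type*} [NonUnitalRing A] [Module K A] [IsScalarTower K A A]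
    [SMulCommClass K A A] (f : Leavitt.Gen E → A) (g : Leavitt.Gen E) :
    freeLift f (Leavitt.gen K g) = f g := by
  simp [freeLift, Leavitt.gen]

/-- The universal property of `L_K(E)`: images of the generators satisfying the defining relations
extend to a homomorphism of non-unital algebras. -/
theorem exists_lift {A : Type*} [NonUnitalRing A] [Module K A] [IsScalarTower K A A]
    [SMulCommClass K A A] (f : Leavitt.Gen E → A)
    (hf : ∀ x y, Leavitt.Rel K E x y → freeLift f x = freeLift f y) :
    ∃ φ : LeavittPathAlgebra K E →ₙₐ[K] A, ∀ g, φ (ofGen K g) = f g := by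
  have key (x y : Leavitt.Free K E) (h : Leavitt.con K E x y) : freeLift f x = freeLift f y := by
    change RingConGen.Rel _ x y at h
    induction h with
    | of x y hr =>
      obtain ⟨k, x', y', h, rfl, rfl⟩ := hr
      rw [map_smul, map_smul, hf _ _ h]
    | refl => rfl
    | symm _ ih => exact ih.symm
    | trans _ _ ih₁ ih₂ => exact ih₁.trans ih₂
    | add _ _ ih₁ ih₂ => rw [map_add, map_add, ih₁, ih₂]
    | mul _ _ ih₁ ih₂ => rw [map_mul, map_mul, ih₁, ih₂]
  refine ⟨{ toFun := Quotient.lift (freeLift f) key, map_smul' := ?_, map_zero' := ?_,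
            map_add' := ?_, map_mul' := ?_ }, fun g => freeLift_gen f g⟩
  · rintro k ⟨x⟩
    exact map_smul (freeLift f) k x
  · exact map_zero (freeLift f)
  · rintro ⟨x⟩ ⟨y⟩
    exact map_add (freeLift f) x y
  · rintro ⟨x⟩ ⟨y⟩
    exact map_mul (freeLift f) x y

end Generators

/-! ### Ideals generated by vertices and saturation -/

section Ideals

variable {K : Type*} [Field K] {E : DirectedGraph.{u, v}}

theorem vertex_mem_ideal {X : Set E.Vertex} {a : E.Vertex} (ha : a ∈ X) :
    vertex K a ∈ ideal K X :=
  TwoSidedIdeal.subset_span (Set.mem_image_of_mem _ ha)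

theorem ideal_le_iff {X : Set E.Vertex} {J : TwoSidedIdeal (LeavittPathAlgebra K E)} :
    ideal K X ≤ J ↔ ∀ a ∈ X, vertex K a ∈ J := by
  rw [ideal, TwoSidedIdeal.span_le, Set.image_subset_iff]
  rfl

theorem vertex_mem_of_satStep {X : Set E.Vertex} {J : TwoSidedIdeal (LeavittPathAlgebra K E)}
    (hX : ∀ a ∈ X, vertex K a ∈ J) (n : ℕ) : ∀ a ∈ E.satStep X n, vertex K a ∈ J := by
  induction n with
  | zero => exact hX
  | succ n ih =>
    rintro a (ha | ⟨hreg, hsub⟩)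
    · exact ih a ha
    · rw [vertex_eq_sum hreg]
      refine sum_mem fun e he => ?_
      rw [← edge_mul_range, mul_assoc]
      refine J.mul_mem_left _ _ (J.mul_mem_right _ _ (ih _ (hsub ⟨e, ?_, rfl⟩)))
      simpa using he

theorem ideal_satClosure (X : Set E.Vertex) : ideal K (E.satClosure X) = ideal K X := by
  apply le_antisymm
  · rw [ideal_le_iff]
    intro a ha
    obtain ⟨n, hn⟩ := Set.mem_iUnion.1 ha
    exact vertex_mem_of_satStep (fun _ => vertex_mem_ideal) n a hn
  · exact ideal_le_iff.2 fun a ha => vertex_mem_ideal (Set.mem_iUnion.2 ⟨0, ha⟩)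

/-! ### Ghost paths and the ideal of a hereditary set -/

/-- For edges `l = [e₁, …, eₙ]` and a vertex `w`, the product `w eₙ* ⋯ e₁*`. It is the ghost path
`(e₁ ⋯ eₙ)*` if `e₁ ⋯ eₙ` is a path ending at `w`; no such condition is imposed on `l`. -/
noncomputable def ghostPath (K : Type*) [Field K] {E : DirectedGraph.{u, v}} :
    List E.Edge → E.Vertex → LeavittPathAlgebra K E
  | [], w => vertex K w
  | e :: l, w => ghostPath K l w * ghost K e

/-- For edges `l = [e₁, …, eₙ]` and a vertex `w`, the product `e₁ ⋯ eₙ w eₙ* ⋯ e₁*`. -/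
noncomputable def rangeProj (K : Type*) [Field K] {E : DirectedGraph.{u, v}} :
    List E.Edge → E.Vertex → LeavittPathAlgebra K E
  | [], w => vertex K w
  | e :: l, w => edge K e * rangeProj K l w * ghost K e

theorem ghostPath_mul_vertex (l : List E.Edge) (w a : E.Vertex) :
    ghostPath K l w * vertex K a = 0 ∨
      ghostPath K l w * vertex K a = ghostPath K l w ∧ E.Reaches a w := by
  induction l generalizing a with
  | nil =>
    by_cases h : w = a
    · subst h
      exact .inr ⟨vertex_mul_self w, .refl⟩
    · exact .inl (vertex_mul_of_ne h)
  | cons e l ih =>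
    simp only [ghostPath, mul_assoc]
    by_cases h : E.source e = a
    · subst h
      rw [ghost_mul_source]
      rcases ih (E.range e) with h0 | ⟨_, hr⟩
      · left
        rw [← range_mul_ghost, ← mul_assoc, h0, zero_mul]
      · exact .inr ⟨rfl, .head ⟨e, rfl, rfl⟩ hr⟩
    · left
      rw [ghost_mul_vertex_of_ne h, mul_zero]

theorem commute_vertex_rangeProj (a : E.Vertex) (l : List E.Edge) (w : E.Vertex) :
    Commute (vertex K a) (rangeProj K l w) := by
  rw [commute_iff_eq]
  cases l with
  | nil =>
    by_cases h : a = w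
    · rw [h]
      rfl
    · rw [rangeProj, vertex_mul_of_ne h, vertex_mul_of_ne (Ne.symm h)]
  | cons e l =>
    simp only [rangeProj]
    by_cases h : a = E.source e
    · subst h
      rw [mul_assoc _ (ghost K e), ghost_mul_source, mul_assoc (edge K e), ← mul_assoc,
        source_mul_edge]
    · rw [mul_assoc _ (ghost K e), ghost_mul_vertex_of_ne (Ne.symm h), mul_assoc (edge K e),
        ← mul_assoc, vertex_mul_edge_of_ne h, zero_mul, mul_zero]

theorem edge_mul_mul_ghost_mul (e : E.Edge) {x : LeavittPathAlgebra K E}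
    (hx : Commute (vertex K (E.range e)) x) (y : LeavittPathAlgebra K E) :
    edge K e * x * ghost K e * (edge K e * y * ghost K e) = edge K e * (x * y) * ghost K e := by
  calc _ = edge K e * (x * (ghost K e * edge K e)) * y * ghost K e := by simp only [mul_assoc]
    _ = edge K e * (vertex K (E.range e) * x) * y * ghost K e := by
      rw [ghost_mul_edge_self, hx.eq]
    _ = edge K e * vertex K (E.range e) * x * y * ghost K e := by simp only [mul_assoc]
    _ = _ := by rw [edge_mul_range]; simp only [mul_assoc]

theorem commute_rangeProj (l : List E.Edge) (w : E.Vertex) (m : List E.Edge) (z : E.Vertex) :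
    Commute (rangeProj K l w) (rangeProj K m z) := by
  induction l generalizing m with
  | nil => exact commute_vertex_rangeProj w m z
  | cons e l ih =>
    cases m with
    | nil => exact (commute_vertex_rangeProj z (e :: l) w).symm
    | cons f m =>
      rw [commute_iff_eq]
      simp only [rangeProj]
      by_cases h : e = f
      · subst h
        rw [edge_mul_mul_ghost_mul e (commute_vertex_rangeProj _ l w),
          edge_mul_mul_ghost_mul e (commute_vertex_rangeProj _ m z), (ih m).eq]
      · have zero {e f : E.Edge} (h : e ≠ f) (x y : LeavittPathAlgebra K E) :
            edge K e * x * ghost K e * (edge K f * y * ghost K f) = 0 := by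
          rw [mul_assoc _ (ghost K e), mul_assoc (edge K f), ← mul_assoc (ghost K e),
            ghost_mul_edge_of_ne h, zero_mul, mul_zero]
        rw [zero h, zero (Ne.symm h)]

theorem ghostPath_mul_rangeProj (l : List E.Edge) (w : E.Vertex) :
    ghostPath K l w * rangeProj K l w = ghostPath K l w := by
  induction l with
  | nil => exact vertex_mul_self w
  | cons e l ih =>
    simp only [rangeProj, ghostPath]
    calc _ = ghostPath K l w * ((ghost K e * edge K e) * rangeProj K l w) * ghost K e := by
          simp only [mul_assoc]
      _ = ghostPath K l w * rangeProj K l w * (vertex K (E.range e) * ghost K e) := by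
        rw [ghost_mul_edge_self, (commute_vertex_rangeProj _ l w).eq]
        simp only [mul_assoc]
      _ = _ := by rw [ih, range_mul_ghost]

theorem rangeProj_mem_ideal {H : Set E.Vertex} {w : E.Vertex} (hw : w ∈ H) (l : List E.Edge) :
    rangeProj K l w ∈ ideal K H := by
  induction l with
  | nil => exact vertex_mem_ideal hw
  | cons e l ih => exact TwoSidedIdeal.mul_mem_right _ _ _ (TwoSidedIdeal.mul_mem_left _ _ _ ih)

/-- The left ideal of `L_K(E)` generated by the ghost paths `β*` with `β` ending in `H`. -/
noncomputable def ghostSpan (K : Type*) [Field K] {E : DirectedGraph.{u, v}} (H : Set E.Vertex) :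
    Submodule K (LeavittPathAlgebra K E) :=
  Submodule.span K {x | ∃ a l, ∃ w ∈ H, x = a * ghostPath K l w}

theorem mul_ghostPath_mem_ghostSpan {H : Set E.Vertex} (a : LeavittPathAlgebra K E)
    (l : List E.Edge) {w : E.Vertex} (hw : w ∈ H) : a * ghostPath K l w ∈ ghostSpan K H :=
  Submodule.subset_span ⟨a, l, w, hw, rfl⟩

theorem mul_mem_ghostSpan_left {H : Set E.Vertex} (b : LeavittPathAlgebra K E)
    {x : LeavittPathAlgebra K E} (hx : x ∈ ghostSpan K H) : b * x ∈ ghostSpan K H := by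
  induction hx using Submodule.span_induction with
  | mem x hx =>
    obtain ⟨a, l, w, hw, rfl⟩ := hx
    rw [← mul_assoc]
    exact mul_ghostPath_mem_ghostSpan _ l hw
  | zero => simp
  | add x y _ _ hx hy =>
    rw [mul_add]
    exact add_mem hx hy
  | smul k x _ hx =>
    rw [mul_smul_comm]
    exact Submodule.smul_mem _ _ hx

/-- Heredity enters here: multiplying the vertex `w ∈ H` on the right by an edge `e` that starts
at `w` gives `e r(e)`, and `r(e) ∈ H`. -/
theorem mul_ofGen_mem_ghostSpan {H : Set E.Vertex} (hH : E.IsHereditary H)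
    {x : LeavittPathAlgebra K E} (hx : x ∈ ghostSpan K H) (g : Leavitt.Gen E) :
    x * ofGen K g ∈ ghostSpan K H := by
  induction hx using Submodule.span_induction with
  | zero => simp
  | add x y _ _ hx hy =>
    rw [add_mul]
    exact add_mem hx hy
  | smul k x _ hx =>
    rw [smul_mul_assoc]
    exact Submodule.smul_mem _ _ hx
  | mem x hx =>
    obtain ⟨a, l, w, hw, rfl⟩ := hx
    rw [mul_assoc]
    have vert (l : List E.Edge) (b : E.Vertex) :
        a * (ghostPath K l w * vertex K b) ∈ ghostSpan K H := by
      rcases ghostPath_mul_vertex (K := K) l w b with h | ⟨h, _⟩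
      · simp [h]
      · rw [h]
        exact mul_ghostPath_mem_ghostSpan a l hw
    cases g with
    | vertex b => exact vert l b
    | ghost e => exact mul_ghostPath_mem_ghostSpan a (e :: l) hw
    | edge e =>
      change a * (ghostPath K l w * edge K e) ∈ _
      cases l with
      | nil =>
        simp only [ghostPath]
        by_cases h : w = E.source e
        · rw [h, source_mul_edge, ← edge_mul_range, ← mul_assoc]
          exact mul_ghostPath_mem_ghostSpan (a * edge K e) []
            (hH w _ (.single ⟨e, h.symm, rfl⟩) hw)
        · simp [vertex_mul_edge_of_ne h]
      | cons f l =>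
        simp only [ghostPath, mul_assoc]
        by_cases h : f = e
        · rw [h, ghost_mul_edge_self]
          exact vert l _
        · simp [ghost_mul_edge_of_ne h]

theorem mul_mem_ghostSpan_right {H : Set E.Vertex} (hH : E.IsHereditary H)
    {x : LeavittPathAlgebra K E} (hx : x ∈ ghostSpan K H) (b : LeavittPathAlgebra K E) :
    x * b ∈ ghostSpan K H := by
  induction b using induction_gen_mul generalizing x with
  | gen g => exact mul_ofGen_mem_ghostSpan hH hx g
  | zero => simp
  | add b c hb hc =>
    rw [mul_add]
    exact add_mem (hb hx) (hc hx)
  | smul k b hb =>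
    rw [mul_smul_comm]
    exact Submodule.smul_mem _ _ (hb hx)
  | gen_mul g b hb =>
    rw [← mul_assoc]
    exact hb (mul_ofGen_mem_ghostSpan hH hx g)

theorem mem_ghostSpan_of_mem_ideal {H : Set E.Vertex} (hH : E.IsHereditary H)
    {x : LeavittPathAlgebra K E} (hx : x ∈ ideal K H) : x ∈ ghostSpan K H := by
  let J : TwoSidedIdeal (LeavittPathAlgebra K E) :=
    .mk' (ghostSpan K H) (zero_mem _) add_mem neg_mem (mul_mem_ghostSpan_left _)
      (mul_mem_ghostSpan_right hH · _)
  have hJ : ideal K H ≤ J := ideal_le_iff.2 fun a ha => by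
    rw [TwoSidedIdeal.mem_mk', ← vertex_mul_self]
    exact mul_ghostPath_mem_ghostSpan (vertex K a) [] ha
  simpa [J, TwoSidedIdeal.mem_mk'] using hJ hx

/-! ### Orthogonality and local units -/

theorem mul_eq_zero_of_mem_ideal {H H' : Set E.Vertex} (hH : E.IsHereditary H)
    (hH' : E.IsHereditary H') (hd : H ∩ H' = ∅) {x y : LeavittPathAlgebra K E}
    (hx : x ∈ ideal K H) (hy : y ∈ ideal K H') : x * y = 0 := by
  have vert {x : LeavittPathAlgebra K E} (hx : x ∈ ghostSpan K H) {b : E.Vertex} (hb : b ∈ H') :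
      x * vertex K b = 0 := by
    induction hx using Submodule.span_induction with
    | zero => simp
    | add x y _ _ hx hy => rw [add_mul, hx, hy, add_zero]
    | smul k x _ hx => rw [smul_mul_assoc, hx, smul_zero]
    | mem x hx =>
      obtain ⟨a, l, w, hw, rfl⟩ := hx
      rcases ghostPath_mul_vertex (K := K) l w b with h | ⟨_, h⟩
      · rw [mul_assoc, h, mul_zero]
      · exact absurd (show w ∈ H ∩ H' from ⟨hw, hH' b w h hb⟩) (by simp [hd])
  let J : TwoSidedIdeal (LeavittPathAlgebra K E) :=
    .mk' {y | ∀ x ∈ ideal K H, x * y = 0} (by simp)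
      (fun {y z} hy hz x hx => by rw [mul_add, hy x hx, hz x hx, add_zero])
      (fun {y} hy x hx => by rw [mul_neg, hy x hx, neg_zero])
      (fun {b y} hy x hx => by rw [← mul_assoc, hy _ (TwoSidedIdeal.mul_mem_right _ _ _ hx)])
      (fun {y b} hy x hx => by rw [← mul_assoc, hy x hx, zero_mul])
  have hJ : ideal K H' ≤ J := ideal_le_iff.2 fun b hb => by
    rw [TwoSidedIdeal.mem_mk']
    exact fun x hx => vert (mem_ghostSpan_of_mem_ideal hH hx) hb
  have := hJ hy
  rw [TwoSidedIdeal.mem_mk'] at this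
  exact this x hx

/-- The ideal of a hereditary set has right local units. The induction proves more: given `u` in
the ideal commuting with all the `ββ*`, a unit can be found for `x` that also is a unit for
everything `u` is a unit for. For a summand `a β*` the join `u + ββ* - u ββ*` does. -/
theorem exists_mul_eq_self {H : Set E.Vertex} (hH : E.IsHereditary H)
    {x : LeavittPathAlgebra K E} (hx : x ∈ ideal K H) : ∃ u ∈ ideal K H, x * u = x := by
  suffices h : ∀ u ∈ ideal K H, (∀ l w, Commute u (rangeProj K l w)) → ∃ u' ∈ ideal K H,
      (∀ l w, Commute u' (rangeProj K l w)) ∧ (∀ z, z * u = z → z * u' = z) ∧ x * u' = x by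
    obtain ⟨u, hu, -, -, h⟩ := h 0 (zero_mem _) fun _ _ => Commute.zero_left _
    exact ⟨u, hu, h⟩
  have hx' := mem_ghostSpan_of_mem_ideal hH hx
  clear hx
  induction hx' using Submodule.span_induction with
  | zero => exact fun u hu hc => ⟨u, hu, hc, fun _ h => h, zero_mul u⟩
  | smul k x _ ih =>
    intro u hu hc
    obtain ⟨u', h1, h2, h3, h4⟩ := ih u hu hc
    exact ⟨u', h1, h2, h3, by rw [smul_mul_assoc, h4]⟩
  | add x y _ _ ihx ihy =>
    intro u hu hc
    obtain ⟨u₁, h1, h2, h3, h4⟩ := ihx u hu hc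
    obtain ⟨u₂, k1, k2, k3, k4⟩ := ihy u₁ h1 h2
    exact ⟨u₂, k1, k2, fun z hz => k3 z (h3 z hz), by rw [add_mul, k3 x h4, k4]⟩
  | mem x hx =>
    obtain ⟨a, l, w, hw, rfl⟩ := hx
    intro u hu hc
    have hp : rangeProj K l w ∈ ideal K H := rangeProj_mem_ideal hw l
    refine ⟨u + rangeProj K l w - u * rangeProj K l w,
      sub_mem (add_mem hu hp) (TwoSidedIdeal.mul_mem_left _ _ _ hp), fun m z => ?_,
      fun z hz => ?_, ?_⟩
    · have := commute_rangeProj (K := K) l w m z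
      exact ((hc m z).add_left this).sub_left ((hc m z).mul_left this)
    · rw [mul_sub, mul_add, ← mul_assoc, hz, add_sub_cancel_right]
    · have h : a * ghostPath K l w * rangeProj K l w = a * ghostPath K l w := by
        rw [mul_assoc, ghostPath_mul_rangeProj]
      rw [(hc l w).eq, mul_sub, mul_add, ← mul_assoc _ (rangeProj K l w), h, add_sub_cancel_left]

end Ideals

end LeavittPathAlgebra

/-! ### Internal direct sums of ideals -/

section DirectSum

/-- A family of pairwise orthogonal ideals with right local units is independent: a unit for the
`i`-th component of a sum annihilates all the other components. -/
theorem isIdealDirectSum_of_orthogonal {R : Type*} [NonUnitalRing R] {Λ : Type*}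
    {J : TwoSidedIdeal R} {I : Λ → TwoSidedIdeal R} (hle : ∀ i, I i ≤ J)
    (hJ : ∀ J' : TwoSidedIdeal R, (∀ i, I i ≤ J') → J ≤ J')
    (horth : ∀ i j, i ≠ j → ∀ x ∈ I i, ∀ y ∈ I j, x * y = 0)
    (hunit : ∀ i, ∀ x ∈ I i, ∃ u ∈ I i, x * u = x) : IsIdealDirectSum J I := by
  classical
  have hof (i : Λ) (x : R) (hx : x ∈ I i) : x ∈ (DirectSum.coeAddMonoidHom I).range :=
    ⟨DirectSum.of (fun i => I i) i ⟨x, hx⟩, DirectSum.coeAddMonoidHom_of I i _⟩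
  constructor
  · convert! (injective_iff_map_eq_zero (DirectSum.coeAddMonoidHom I)).2 fun f hf => ?_ using 1
    ext i
    obtain ⟨u, hu, hfu⟩ := hunit i _ (f i).2
    have key (f : ⨁ i, I i) : DirectSum.coeAddMonoidHom I f * u = (f i : R) * u := by
      induction f using DirectSum.induction_on with
      | zero => simp
      | of j x =>
        rw [DirectSum.coeAddMonoidHom_of]
        by_cases h : j = i
        · subst h
          rw [DirectSum.of_eq_same]
        · rw [DirectSum.of_eq_of_ne _ _ _ (Ne.symm h), horth j i h _ x.2 u hu]
          simp
      | add f g hf hg => rw [map_add, add_mul, hf, hg, DirectSum.add_apply, ← add_mul]; rfl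
    rw [← hfu, ← key, hf, zero_mul]
    rfl
  · apply Set.Subset.antisymm
    · rintro _ ⟨f, rfl⟩
      induction f using DirectSum.induction_on with
      | zero => simp
      | of i x =>
        have := hle i x.2
        convert! this using 1
        exact DirectSum.coeAddMonoidHom_of I i x
      | add f g hf hg => rw [map_add]; exact J.add_mem hf hg
    · have mul (x : R) (f : ⨁ i, I i) :
          x * DirectSum.coeAddMonoidHom I f ∈ (DirectSum.coeAddMonoidHom I).range ∧
          DirectSum.coeAddMonoidHom I f * x ∈ (DirectSum.coeAddMonoidHom I).range := by
        induction f using DirectSum.induction_on with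
        | zero => simp
        | of i y =>
          rw [DirectSum.coeAddMonoidHom_of]
          exact ⟨hof i _ ((I i).mul_mem_left _ _ y.2), hof i _ ((I i).mul_mem_right _ _ y.2)⟩
        | add f g hf hg =>
          rw [map_add, mul_add, add_mul]
          exact ⟨add_mem hf.1 hg.1, add_mem hf.2 hg.2⟩
      let J' : TwoSidedIdeal R :=
        .mk' (DirectSum.coeAddMonoidHom I).range (zero_mem _) add_mem neg_mem
          (by rintro x _ ⟨f, rfl⟩; exact (mul x f).1) (by rintro _ x ⟨f, rfl⟩; exact (mul x f).2)
      intro x hx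
      have := hJ J' (fun i x hx => (TwoSidedIdeal.mem_mk' ..).2 (hof i x hx)) hx
      rw [TwoSidedIdeal.mem_mk'] at this
      convert! this

end DirectSum

namespace LeavittPathAlgebra

theorem isIdealDirectSum_ideal {K : Type*} [Field K] {E : DirectedGraph.{u, v}} {Λ : Type*}
    {H : Λ → Set E.Vertex} (hH : ∀ i, E.IsHereditary (H i))
    (hd : ∀ i j, i ≠ j → H i ∩ H j = ∅) :
    IsIdealDirectSum (ideal K (⋃ i, H i)) (fun i => ideal K (H i)) := by
  refine isIdealDirectSum_of_orthogonal (fun i => ?_) (fun J' hJ' => ?_)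
    (fun i j h x hx y hy => mul_eq_zero_of_mem_ideal (hH i) (hH j) (hd i j h) hx hy)
    (fun i x hx => exists_mul_eq_self (hH i) hx)
  · exact ideal_le_iff.2 fun a ha => vertex_mem_ideal (Set.mem_iUnion.2 ⟨i, ha⟩)
  · refine ideal_le_iff.2 fun a ha => ?_
    obtain ⟨i, hi⟩ := Set.mem_iUnion.1 ha
    exact hJ' i (vertex_mem_ideal hi)

/-! ### Subgraphs closed under adjacent edges -/

section Subgraph

variable {K : Type*} [Field K] {E : DirectedGraph.{u, v}}

/-- The vertex at which a generator starts, a ghost edge being read backwards. -/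
def genSource : Leavitt.Gen E → E.Vertex
  | .vertex a => a
  | .edge e => E.source e
  | .ghost e => E.range e

/-- The vertex at which a generator ends, a ghost edge being read backwards. -/
def genRange : Leavitt.Gen E → E.Vertex
  | .vertex a => a
  | .edge e => E.range e
  | .ghost e => E.source e

theorem genSource_mul (g : Leavitt.Gen E) : vertex K (genSource g) * ofGen K g = ofGen K g := by
  cases g with
  | vertex a => exact vertex_mul_self a
  | edge e => exact source_mul_edge e
  | ghost e => exact range_mul_ghost e

theorem mul_genRange (g : Leavitt.Gen E) : ofGen K g * vertex K (genRange g) = ofGen K g := by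
  cases g with
  | vertex a => exact vertex_mul_self a
  | edge e => exact edge_mul_range e
  | ghost e => exact ghost_mul_source e

theorem ofGen_mul_ofGen_of_ne {g h : Leavitt.Gen E} (hne : genRange g ≠ genSource h) :
    ofGen K g * ofGen K h = 0 := by
  rw [← mul_genRange g, ← genSource_mul h, mul_assoc, ← mul_assoc (vertex K _),
    vertex_mul_of_ne hne, zero_mul, mul_zero]

variable {G : E.Subgraph}

/-- A generator for a subgraph of `E`, as a generator for `E`. -/
def inclGen (G : E.Subgraph) : Leavitt.Gen G.toGraph → Leavitt.Gen E
  | .vertex a => .vertex a.1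
  | .edge e => .edge e.1
  | .ghost e => .ghost e.1

theorem inclGen_injective : Function.Injective (inclGen G) := by
  rintro (a | a | a) (b | b | b) h <;>
    simp only [inclGen, reduceCtorEq, Leavitt.Gen.vertex.injEq, Leavitt.Gen.edge.injEq,
      Leavitt.Gen.ghost.injEq] at h <;> rw [Subtype.ext h]

theorem genSource_inclGen_mem (g : Leavitt.Gen G.toGraph) : genSource (inclGen G g) ∈ G.verts := by
  cases g with
  | vertex a => exact a.2
  | edge e => exact G.source_mem _ e.2
  | ghost e => exact G.range_mem _ e.2

theorem genRange_inclGen_mem (g : Leavitt.Gen G.toGraph) : genRange (inclGen G g) ∈ G.verts := by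
  cases g with
  | vertex a => exact a.2
  | edge e => exact G.range_mem _ e.2
  | ghost e => exact G.source_mem _ e.2

theorem emitted_eq_image (hs : ∀ e, E.source e ∈ G.verts → e ∈ G.edges) (a : G.toGraph.Vertex) :
    E.emitted a.1 = (fun e : G.toGraph.Edge => e.1) '' G.toGraph.emitted a := by
  ext e
  constructor
  · intro he
    have he' : E.source e = a.1 := he
    exact ⟨⟨e, hs e (he' ▸ a.2)⟩, Subtype.ext he', rfl⟩
  · rintro ⟨e, he, rfl⟩
    exact congrArg Subtype.val he

theorem edge_val_injective :
    Function.Injective fun e : G.toGraph.Edge => (e.1 : E.Edge) :=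
  Subtype.val_injective

theorem isRegular_toGraph_iff (hs : ∀ e, E.source e ∈ G.verts → e ∈ G.edges)
    (a : G.toGraph.Vertex) : G.toGraph.IsRegular a ↔ E.IsRegular a.1 := by
  unfold DirectedGraph.IsRegular
  rw [emitted_eq_image hs, Set.image_nonempty, Set.finite_image_iff edge_val_injective.injOn]

theorem sum_emitted_eq {M : Type*} [AddCommMonoid M]
    (hs : ∀ e, E.source e ∈ G.verts → e ∈ G.edges) (a : G.toGraph.Vertex)
    (h : (G.toGraph.emitted a).Finite) (h' : (E.emitted a.1).Finite) (f : E.Edge → M) :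
    ∑ e ∈ h'.toFinset, f e = ∑ e ∈ h.toFinset, f e.1 := by
  classical
  have : h'.toFinset = h.toFinset.image fun e : G.toGraph.Edge => e.1 := by
    ext e
    rw [Set.Finite.mem_toFinset, emitted_eq_image hs, Finset.mem_image]
    simp only [Set.mem_image, Set.Finite.mem_toFinset]
  rw [this, Finset.sum_image edge_val_injective.injOn]

/-- If the subgraph `G` contains every edge starting in it, the inclusion induces a homomorphism
of the Leavitt path algebras. -/
theorem exists_inclusion (K : Type*) [Field K]
    (hs : ∀ e, E.source e ∈ G.verts → e ∈ G.edges) :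
    ∃ ι : LeavittPathAlgebra K G.toGraph →ₙₐ[K] LeavittPathAlgebra K E,
      ∀ g, ι (ofGen K g) = ofGen K (inclGen G g) := by
  refine exists_lift _ fun x y h => ?_
  cases h with
  | vertex_self a => simpa using! vertex_mul_self a.1
  | vertex_ne a b h => simpa using! vertex_mul_of_ne (Subtype.val_injective.ne h)
  | source_edge e => simpa using! source_mul_edge e.1
  | edge_range e => simpa using! edge_mul_range e.1
  | range_ghost e => simpa using! range_mul_ghost e.1
  | ghost_source e => simpa using! ghost_mul_source e.1
  | ck1_self e => simpa using! ghost_mul_edge_self e.1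
  | ck1_ne e f h => simpa using! ghost_mul_edge_of_ne (Subtype.val_injective.ne h)
  | ck2 a h =>
    have h' := (isRegular_toGraph_iff hs a).1 h
    simp only [map_sum, map_mul, freeLift_gen]
    exact (vertex_eq_sum h').trans (sum_emitted_eq hs a h.1 h'.1 _)

/-- If the subgraph `G` contains every edge starting or ending in it, then sending the generators
outside `G` to zero defines a homomorphism onto the Leavitt path algebra of `G`. -/
theorem exists_projection (K : Type*) [Field K]
    (hs : ∀ e, E.source e ∈ G.verts → e ∈ G.edges)
    (hr : ∀ e, E.range e ∈ G.verts → e ∈ G.edges) :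
    ∃ π : LeavittPathAlgebra K E →ₙₐ[K] LeavittPathAlgebra K G.toGraph,
      (∀ g, π (ofGen K (inclGen G g)) = ofGen K g) ∧
        ∀ g, (∀ g', inclGen G g' ≠ g) → π (ofGen K g) = 0 := by
  let F : Leavitt.Gen E → LeavittPathAlgebra K G.toGraph :=
    Function.extend (inclGen G) (ofGen K) 0
  have hF (g) : F (inclGen G g) = ofGen K g := inclGen_injective.extend_apply _ _ g
  have hF0 (g) (hg : ∀ g', inclGen G g' ≠ g) : F g = 0 :=
    Function.extend_apply' _ _ _ fun ⟨g', h⟩ => hg g' h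
  have hV (a : G.verts) : F (.vertex a.1) = vertex K (E := G.toGraph) a := hF (.vertex a)
  have hE (e : G.edges) : F (.edge e.1) = edge K (E := G.toGraph) e := hF (.edge e)
  have hS (e : G.edges) : F (.ghost e.1) = ghost K (E := G.toGraph) e := hF (.ghost e)
  have hV0 {a} (h : a ∉ G.verts) : F (.vertex a) = 0 := hF0 _ fun g' hg' => by
    cases g' <;> cases hg'
    exact h (Subtype.property _)
  have hE0 {e} (h : e ∉ G.edges) : F (.edge e) = 0 := hF0 _ fun g' hg' => by
    cases g' <;> cases hg'
    exact h (Subtype.property _)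
  have hS0 {e} (h : e ∉ G.edges) : F (.ghost e) = 0 := hF0 _ fun g' hg' => by
    cases g' <;> cases hg'
    exact h (Subtype.property _)
  suffices h : ∀ x y, Leavitt.Rel K E x y → freeLift F x = freeLift F y by
    obtain ⟨π, hπ⟩ := exists_lift F h
    exact ⟨π, fun g => by rw [hπ, hF], fun g hg => by rw [hπ, hF0 g hg]⟩
  intro x y h
  cases h with
  | vertex_self a =>
    simp only [map_mul, freeLift_gen]
    by_cases h : a ∈ G.verts
    · rw [hV ⟨a, h⟩]
      exact vertex_mul_self (E := G.toGraph) ⟨a, h⟩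
    · rw [hV0 h, zero_mul]
  | vertex_ne a b hab =>
    simp only [map_mul, freeLift_gen, map_zero]
    by_cases h : a ∈ G.verts
    · by_cases h' : b ∈ G.verts
      · rw [hV ⟨a, h⟩, hV ⟨b, h'⟩]
        exact vertex_mul_of_ne fun h => hab (congrArg Subtype.val h)
      · rw [hV0 h', mul_zero]
    · rw [hV0 h, zero_mul]
  | source_edge e =>
    simp only [map_mul, freeLift_gen]
    by_cases h : e ∈ G.edges
    · rw [hE ⟨e, h⟩, hV ⟨_, G.source_mem e h⟩]
      exact source_mul_edge (E := G.toGraph) ⟨e, h⟩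
    · rw [hE0 h, mul_zero]
  | edge_range e =>
    simp only [map_mul, freeLift_gen]
    by_cases h : e ∈ G.edges
    · rw [hE ⟨e, h⟩, hV ⟨_, G.range_mem e h⟩]
      exact edge_mul_range (E := G.toGraph) ⟨e, h⟩
    · rw [hE0 h, zero_mul]
  | range_ghost e =>
    simp only [map_mul, freeLift_gen]
    by_cases h : e ∈ G.edges
    · rw [hS ⟨e, h⟩, hV ⟨_, G.range_mem e h⟩]
      exact range_mul_ghost (E := G.toGraph) ⟨e, h⟩
    · rw [hS0 h, mul_zero]
  | ghost_source e =>
    simp only [map_mul, freeLift_gen]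
    by_cases h : e ∈ G.edges
    · rw [hS ⟨e, h⟩, hV ⟨_, G.source_mem e h⟩]
      exact ghost_mul_source (E := G.toGraph) ⟨e, h⟩
    · rw [hS0 h, zero_mul]
  | ck1_self e =>
    simp only [map_mul, freeLift_gen]
    by_cases h : e ∈ G.edges
    · rw [hE ⟨e, h⟩, hS ⟨e, h⟩, hV ⟨_, G.range_mem e h⟩]
      exact ghost_mul_edge_self (E := G.toGraph) ⟨e, h⟩
    · rw [hS0 h, zero_mul, hV0 fun h' => h (hr e h')]
  | ck1_ne e f hef =>
    simp only [map_mul, freeLift_gen, map_zero]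
    by_cases h : e ∈ G.edges
    · by_cases h' : f ∈ G.edges
      · rw [hS ⟨e, h⟩, hE ⟨f, h'⟩]
        exact ghost_mul_edge_of_ne fun h => hef (congrArg Subtype.val h)
      · rw [hE0 h', mul_zero]
    · rw [hS0 h, zero_mul]
  | ck2 a ha =>
    simp only [map_sum, map_mul, freeLift_gen]
    by_cases h : a ∈ G.verts
    · have h' := (isRegular_toGraph_iff hs ⟨a, h⟩).2 ha
      rw [hV ⟨a, h⟩, vertex_eq_sum h', sum_emitted_eq hs ⟨a, h⟩ h'.1 ha.1]
      exact Finset.sum_congr rfl fun e _ => by rw [hE e, hS e]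
    · rw [hV0 h, Finset.sum_eq_zero]
      intro e he
      have he' : E.source e = a := by simpa using! he
      rw [hE0 fun h' => h (he' ▸ G.source_mem e h'), zero_mul]

end Subgraph

/-! ### Disjoint unions of graphs -/

/-- The isomorphism is assembled from the projections `π i` to the Leavitt path algebras of the
components; its inverse is the sum of the inclusions `ι i`. -/
theorem exists_bijective_of_isDisjointUnion (K : Type*) [Field K] {E : DirectedGraph.{u, v}}
    {Λ : Type*} {G : Λ → E.Subgraph} (hG : E.IsDisjointUnion G) :
    ∃ φ : LeavittPathAlgebra K E →ₙₐ[K]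
        algebraDirectSum K (fun i => LeavittPathAlgebra K (G i).toGraph),
      Function.Bijective φ := by
  classical
  have disj {i j} {a} (hi : a ∈ (G i).verts) (hj : a ∈ (G j).verts) : i = j :=
    (hG.1 a).unique hi hj
  have hs (i) (e) (h : E.source e ∈ (G i).verts) : e ∈ (G i).edges := by
    obtain ⟨j, hj, -⟩ := hG.2 e
    rwa [disj h ((G j).source_mem e hj)]
  have hr (i) (e) (h : E.range e ∈ (G i).verts) : e ∈ (G i).edges := by
    obtain ⟨j, hj, -⟩ := hG.2 e
    rwa [disj h ((G j).range_mem e hj)]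
  -- A vertex lies in only one component, so each component contains all edges adjacent to it.
  choose ι hι using fun i => exists_inclusion K (hs i)
  choose π hπ hπ0 using fun i => exists_projection K (hs i) (hr i)
  have exists_gen (g : Leavitt.Gen E) : ∃ i g', inclGen (G i) g' = g := by
    cases g with
    | vertex a =>
      obtain ⟨i, hi, -⟩ := hG.1 a
      exact ⟨i, .vertex ⟨a, hi⟩, rfl⟩
    | edge e =>
      obtain ⟨i, hi, -⟩ := hG.2 e
      exact ⟨i, .edge ⟨e, hi⟩, rfl⟩
    | ghost e =>
      obtain ⟨i, hi, -⟩ := hG.2 e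
      exact ⟨i, .ghost ⟨e, hi⟩, rfl⟩
  have πι (i) (y) : π i (ι i y) = y := by
    induction y using induction_gen_mul with
    | gen g => rw [hι, hπ]
    | zero => simp
    | add x y hx hy => rw [map_add, map_add, hx, hy]
    | smul k x hx => rw [map_smul, map_smul, hx]
    | gen_mul g x hx => rw [map_mul, map_mul, hx, hι, hπ]
  have gen0 {i j} (h : i ≠ j) (g) : π j (ofGen K (inclGen (G i) g)) = 0 :=
    hπ0 _ _ fun g' hg' =>
      h (disj (genSource_inclGen_mem g) (hg' ▸ genSource_inclGen_mem g'))
  have πι0 {i j} (h : i ≠ j) (y) : π j (ι i y) = 0 := by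
    induction y using induction_gen_mul with
    | gen g => rw [hι, gen0 h]
    | zero => simp
    | add x y hx hy => rw [map_add, map_add, hx, hy, add_zero]
    | smul k x hx => rw [map_smul, map_smul, hx, smul_zero]
    | gen_mul g x hx => rw [map_mul, map_mul, hx, mul_zero]
  have orth {i j} (h : i ≠ j) (g) (y) : ofGen K (inclGen (G i) g) * ι j y = 0 := by
    have gg (g') : ofGen K (inclGen (G i) g) * ofGen K (inclGen (G j) g') = 0 :=
      ofGen_mul_ofGen_of_ne fun h' =>
        h (disj (genRange_inclGen_mem g) (h' ▸ genSource_inclGen_mem g'))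
    induction y using induction_gen_mul with
    | gen g' => rw [hι, gg]
    | zero => simp
    | add x y hx hy => rw [map_add, mul_add, hx, hy, add_zero]
    | smul k x hx => rw [map_smul, mul_smul_comm, hx, smul_zero]
    | gen_mul g' x hx => rw [map_mul, ← mul_assoc, hι, gg, zero_mul]
  have decomp (x) : ∃ s : Finset Λ, ∀ t, s ⊆ t → ∑ i ∈ t, ι i (π i x) = x := by
    induction x using induction_gen_mul with
    | gen g =>
      obtain ⟨i, g, rfl⟩ := exists_gen g
      refine ⟨{i}, fun t ht => ?_⟩
      rw [Finset.sum_eq_single_of_mem i (by simpa using ht), hπ, hι]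
      intro j _ hj
      rw [gen0 (Ne.symm hj), map_zero]
    | zero => exact ⟨∅, fun t _ => by simp⟩
    | add x y hx hy =>
      obtain ⟨s, hs⟩ := hx
      obtain ⟨s', hs'⟩ := hy
      refine ⟨s ∪ s', fun t ht => ?_⟩
      simp only [map_add, Finset.sum_add_distrib]
      rw [hs t (Finset.union_subset_left ht), hs' t (Finset.union_subset_right ht)]
    | smul k x hx =>
      obtain ⟨s, hs⟩ := hx
      refine ⟨s, fun t ht => ?_⟩
      simp only [map_smul]
      rw [← Finset.smul_sum, hs t ht]
    | gen_mul g x hx =>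
      obtain ⟨s, hs⟩ := hx
      obtain ⟨i, g, rfl⟩ := exists_gen g
      refine ⟨insert i s, fun t ht => ?_⟩
      have hi : i ∈ t := ht (Finset.mem_insert_self i s)
      conv_rhs => rw [← hs t ((Finset.subset_insert i s).trans ht), Finset.mul_sum]
      rw [Finset.sum_eq_single_of_mem i hi, Finset.sum_eq_single_of_mem i hi, map_mul, map_mul, hπ,
        hι]
      · intro j _ hj
        exact orth (Ne.symm hj) g _
      · intro j _ hj
        rw [map_mul, gen0 (Ne.symm hj), zero_mul, map_zero]
  let Φ : LeavittPathAlgebra K E →ₙₐ[K] ∀ i, LeavittPathAlgebra K (G i).toGraph :=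
    { toFun := fun x i => π i x
      map_smul' := fun k x => funext fun i => map_smul (π i) k x
      map_zero' := funext fun i => map_zero (π i)
      map_add' := fun x y => funext fun i => map_add (π i) x y
      map_mul' := fun x y => funext fun i => map_mul (π i) x y }
  have hΦ (x) : Φ x ∈ algebraDirectSum K (fun i => LeavittPathAlgebra K (G i).toGraph) := by
    obtain ⟨s, hs⟩ := decomp x
    refine s.finite_toSet.subset fun j hj => ?_
    by_contra hjs
    refine hj ?_
    change π j x = 0
    rw [← hs s subset_rfl, map_sum]
    refine Finset.sum_eq_zero fun i hi => πι0 ?_ _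
    rintro rfl
    exact hjs hi
  refine ⟨NonUnitalAlgHom.codRestrict Φ _ hΦ, ?_, ?_⟩
  · refine (injective_iff_map_eq_zero _).2 fun x hx => ?_
    obtain ⟨s, hs⟩ := decomp x
    have h0 (i) : π i x = 0 := congrFun (congrArg Subtype.val hx) i
    rw [← hs s subset_rfl]
    exact Finset.sum_eq_zero fun i _ => by rw [h0, map_zero]
  · rintro ⟨f, hf⟩
    have hf' : {i | f i ≠ 0}.Finite := hf
    refine ⟨∑ i ∈ hf'.toFinset, ι i (f i), Subtype.ext (funext fun j => ?_)⟩
    change π j (∑ i ∈ hf'.toFinset, ι i (f i)) = f j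
    rw [map_sum, Finset.sum_eq_single j, πι]
    · exact fun i _ h => πι0 h _
    · intro hj
      have : f j = 0 := by simpa using hj
      rw [this, map_zero, map_zero]

end LeavittPathAlgebra

theorem proposition1p6 {K : Type*} [Field K] (E : DirectedGraph) (Λ : Type*) :
    (∀ H : Λ → Set E.Vertex, (∀ i, E.IsHereditary (H i)) → (∀ i j, i ≠ j → H i ∩ H j = ∅) →
      LeavittPathAlgebra.ideal K (E.satClosure (⋃ i, H i)) =
          LeavittPathAlgebra.ideal K (⋃ i, H i) ∧
        IsIdealDirectSum (LeavittPathAlgebra.ideal K (⋃ i, H i))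
          (fun i => LeavittPathAlgebra.ideal K (H i)) ∧
        IsIdealDirectSum (LeavittPathAlgebra.ideal K (⋃ i, H i))
          (fun i => LeavittPathAlgebra.ideal K (E.satClosure (H i))) ∧
        ∀ i, LeavittPathAlgebra.ideal K (H i) = LeavittPathAlgebra.ideal K (E.satClosure (H i))) ∧
    (∀ G : Λ → E.Subgraph, E.IsDisjointUnion G → (∀ i, (G i).toGraph.IsConnected) →
      ∃ φ : LeavittPathAlgebra K E →ₙₐ[K]
          algebraDirectSum K (fun i => LeavittPathAlgebra K (G i).toGraph),
        Function.Bijective φ) := by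
  refine ⟨fun H hH hd => ?_, fun G hG _ =>
    LeavittPathAlgebra.exists_bijective_of_isDisjointUnion K hG⟩
  have h := LeavittPathAlgebra.isIdealDirectSum_ideal (K := K) hH hd
  simp only [LeavittPathAlgebra.ideal_satClosure]
  exact ⟨trivial, h, h, fun _ => trivial⟩
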